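/- Let $n\ge 5$ and $c\ge 1$. Let $UV_n(c)$ be the group with generators $\rho_i$ and $\sigma_{i,t}$ ($1\le i\le n-1$, $1\le t\le c$) and relations $\rho_i\rho_{i+1}\rho_i=\rho_{i+1}\rho_i\rho_{i+1}$ and $\rho_i\rho_{i+1}\sigma_{i,t}=\sigma_{i+1,t}\rho_i\rho_{i+1}$ for $1\le i\le n-2$; $\rho_i^2=1$ for all $i$; and $\rho_i\rho_j=\rho_j\rho_i$, $\sigma_{i,t}\sigma_{j,\ell}=\sigma_{j,\ell}\sigma_{i,t}$, $\sigma_{i,t}\rho_j=\rho_j\sigma_{i,t}$ for $|i-j|\ge 2$ (in all cases for all $1\le t,\ell\le c$). Let $UW_n(c)$ be the quotient of $UV_n(c)$ by the normal closure of the elements $\rho_i\sigma_{i+1,t}\sigma_{i,t}(\sigma_{i+1,t}\sigma_{i,t}\rho_{i+1})^{-1}$, $1\le i\le n-2$, $1\le t\le c$. Let $S_n$ be the symmetric group on $n$ letters. Then: 1. There is a surjective homomorphism $UW_n(c)\to S_n$. 2. Every finite non-abelian quotient of $UW_n(c)$ has order at least $n!$. 3. Every non-abelian quotient of $UW_n(c)$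 of order $n!$ is isomorphic to $S_n$. 4. If $n\neq 6$, any two surjective homomorphisms $UW_n(c)\to S_n$ differ by conjugation by an element of $S_n$. 5. If $n=6$, then $S_6$ has a non-inner automorphism, and for every non-inner automorphism $\nu$ of $S_6$ and every surjective homomorphism $\varphi\colon UW_6(c)\to S_6$, the map $\nu\circ\varphi$ is a surjective homomorphism that does not differ from $\varphi$ by a conjugation in $S_6$, and every surjective homomorphism $UW_6(c)\to S_6$ differs by a conjugation in $S_6$ from $\varphi$ or from $\nu\circ\varphi$. -/

import Mathlib

/-- Generators of the universal virtual braid group on `n` strands with `c` types of non-virtual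
crossings: `rho i` and `sigma i t`, where `i` runs over `n - 1` positions (numbered from `0`) and
`t` over `c` types. -/
inductive UVGen (n c : ℕ) : Type
  | rho (i : Fin (n - 1)) : UVGen n c
  | sigma (i : Fin (n - 1)) (t : Fin c) : UVGen n c

namespace UVGen

/-- The generator `ρ i`, as an element of the free group. -/
def r {n c : ℕ} (i : Fin (n - 1)) : FreeGroup (UVGen n c) := FreeGroup.of (rho i)

/-- The generator `σ i t`, as an element of the free group. -/
def s {n c : ℕ} (i : Fin (n - 1)) (t : Fin c) : FreeGroup (UVGen n c) := FreeGroup.of (sigma i t)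

end UVGen

open UVGen in
/-- The relators of the universal virtual braid group; a relation `u = v` is recorded as the
relator `u * v⁻¹`. In `pr1` and `mr2` the position `j` is `i + 1`. -/
inductive UVRel (n c : ℕ) : FreeGroup (UVGen n c) → Prop
  | pr1 (i j : Fin (n - 1)) (h : (j : ℕ) = i + 1) :
      UVRel n c ((r i * r j * r i) * (r j * r i * r j)⁻¹)
  | pr2 (i j : Fin (n - 1)) (h : 2 ≤ |(i : ℤ) - (j : ℤ)|) :
      UVRel n c ((r i * r j) * (r j * r i)⁻¹)
  | pr3 (i : Fin (n - 1)) :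
      UVRel n c (r i ^ 2)
  | cr (i j : Fin (n - 1)) (t l : Fin c) (h : 2 ≤ |(i : ℤ) - (j : ℤ)|) :
      UVRel n c ((s i t * s j l) * (s j l * s i t)⁻¹)
  | mr1 (i j : Fin (n - 1)) (t : Fin c) (h : 2 ≤ |(i : ℤ) - (j : ℤ)|) :
      UVRel n c ((s i t * r j) * (r j * s i t)⁻¹)
  | mr2 (i j : Fin (n - 1)) (t : Fin c) (h : (j : ℕ) = i + 1) :
      UVRel n c ((r i * r j * s i t) * (s j t * r i * r j)⁻¹)

/-- The universal virtual braid group `UV_n(c)`. -/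
abbrev UV (n c : ℕ) : Type := PresentedGroup {w : FreeGroup (UVGen n c) | UVRel n c w}

namespace UV

/-- The generator `ρ i` of `UV_n(c)`. -/
def rho {n c : ℕ} (i : Fin (n - 1)) : UV n c := PresentedGroup.of (UVGen.rho i)

/-- The generator `σ i t` of `UV_n(c)`. -/
def sigma {n c : ℕ} (i : Fin (n - 1)) (t : Fin c) : UV n c := PresentedGroup.of (UVGen.sigma i t)

/-- The elements `ρ_i σ_{i+1,t} σ_{i,t} (σ_{i+1,t} σ_{i,t} ρ_{i+1})⁻¹` of `UV_n(c)`. -/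
def weldedRelators (n c : ℕ) : Set (UV n c) :=
  {w | ∃ (i j : Fin (n - 1)) (t : Fin c), (j : ℕ) = i + 1 ∧
    w = (rho i * sigma j t * sigma i t) * (sigma j t * sigma i t * rho j)⁻¹}

end UV

/-- The universal welded braid group `UW_n(c)`: the quotient of `UV_n(c)` by the normal closure of
the welded relators. -/
abbrev UW (n c : ℕ) : Type := UV n c ⧸ Subgroup.normalClosure (UV.weldedRelators n c)

/-- `ψ` is `φ` followed by conjugation by an element of the target group. -/
def ConjugateHoms {H G : Type*} [Group H] [Group G] (φ ψ : H →* G) : Prop :=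
  ∃ g : G, ∀ x : H, ψ x = g * φ x * g⁻¹

/-- An automorphism that is not conjugation by an element of the group. For the symmetric group on
six letters there is exactly one such automorphism up to inner automorphisms. -/
def IsNonInner {G : Type*} [Group G] (ν : MulAut G) : Prop :=
  ¬ ∃ g : G, ν = MulAut.conj g

/-! Identifying each `σ i t` with `ρ i` gives the standard map `π` onto the symmetric group, and the
Coxeter presentation gives a map `ι` back, sending adjacent transpositions to the `ρ i`.

Let `ψ` map onto a non-abelian group. If `ψ ∘ ι` is not injective, its kernel contains the
alternating group, so all `ρ i` have the same image; the mixed and far-commutation relations then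
make the image abelian (`UW.commute_of_map_rho_eq`). Hence `ψ ∘ ι` is injective, which gives the
order bound and the case of equality.

If the target is the symmetric group, `ψ ∘ ι` is an automorphism. After dividing by it, `ρ i` goes
to the adjacent transposition, and centralisers together with the welded relation force `σ i t` to
the same value (`UW.map_sigma_eq`). So every surjection is `π` followed by an automorphism, and
uniqueness becomes a question about automorphisms of symmetric groups. These preserve transpositions
except possibly on six letters, because a product of two conjugate transpositions has sixth power
`1`, a property that other classes of involutions lack. -/

open Equiv Equiv.Perm

/-! ### Coxeter presentation of the symmetric group -/

/-- The elements `r 0, …, r (m - 1)` of a group satisfy the Coxeter relations of type `A_m`. -/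
structure IsCoxeterFamilyA {G : Type*} [Group G] (m : ℕ) (r : ℕ → G) : Prop where
  sq : ∀ i < m, r i * r i = 1
  braid : ∀ i, i + 1 < m → r i * r (i + 1) * r i = r (i + 1) * r i * r (i + 1)
  comm : ∀ i j, i + 2 ≤ j → j < m → r i * r j = r j * r i

/-- The product `r j * r (j + 1) * ⋯ * r (j + k - 1)`. -/
def ascendingProd {G : Type*} [Group G] (r : ℕ → G) : ℕ → ℕ → G
  | _, 0 => 1
  | j, k + 1 => r j * ascendingProd r (j + 1) k

namespace IsCoxeterFamilyA

variable {G : Type*} [Group G] {m : ℕ} {r : ℕ → G}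

theorem mono (h : IsCoxeterFamilyA m r) {l : ℕ} (hl : l ≤ m) : IsCoxeterFamilyA l r where
  sq i hi := h.sq i (by omega)
  braid i hi := h.braid i (by omega)
  comm i j hij hj := h.comm i j hij (by omega)

theorem mul_ascendingProd_of_lt (h : IsCoxeterFamilyA m r) (i j k : ℕ) (hij : i + 2 ≤ j)
    (hk : j + k ≤ m) : r i * ascendingProd r j k = ascendingProd r j k * r i := by
  induction k generalizing j with
  | zero => simp [ascendingProd]
  | succ k ih =>
    rw [ascendingProd, ← mul_assoc, h.comm i j hij (by omega), mul_assoc,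
      ih (j + 1) (by omega) (by omega), mul_assoc]

/-- Factors before `r i` commute with `r (i + 1)`, the braid relation turns `r (i + 1)` into `r i`,
and the later factors commute with `r i`. -/
theorem mul_ascendingProd_of_mem (h : IsCoxeterFamilyA m r) (i j k : ℕ) (hij : j ≤ i)
    (hi : i + 1 < j + k) (hk : j + k ≤ m) :
    r (i + 1) * ascendingProd r j k = ascendingProd r j k * r i := by
  induction k generalizing j with
  | zero => omega
  | succ k ih =>
    rcases hij.eq_or_lt with rfl | hlt
    · obtain ⟨l, rfl⟩ : ∃ l, k = l + 1 := ⟨k - 1, by omega⟩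
      have hc := h.mul_ascendingProd_of_lt j (j + 1 + 1) l (by omega) (by omega)
      have hb := h.braid j (by omega)
      simp only [ascendingProd]
      calc r (j + 1) * (r j * (r (j + 1) * ascendingProd r (j + 1 + 1) l))
          = (r (j + 1) * r j * r (j + 1)) * ascendingProd r (j + 1 + 1) l := by group
        _ = r j * r (j + 1) * (r j * ascendingProd r (j + 1 + 1) l) := by rw [← hb]; group
        _ = _ := by rw [hc]; group
    · rw [ascendingProd, ← mul_assoc, ← h.comm j (i + 1) (by omega) (by omega), mul_assoc,
        ih (j + 1) (by omega) (by omega) (by omega), mul_assoc]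

/-- The parabolic subgroup of type `A_m` has at most `m + 1` left cosets in that of type
`A_(m+1)`. -/
theorem exists_eq_ascendingProd_mul (h : IsCoxeterFamilyA (m + 1) r) {x : G}
    (hx : x ∈ Subgroup.closure (r '' Set.Iio (m + 1))) :
    ∃ j ≤ m + 1, ∃ k ∈ Subgroup.closure (r '' Set.Iio m),
      x = ascendingProd r j (m + 1 - j) * k := by
  -- Left multiplication by `r i` lengthens the product if `i + 1 = j` and shortens it if `i = j`.
  -- Otherwise it passes through to `k`, as `r i` for `i + 1 < j` and as `r (i - 1)` for `i > j`.
  have step : ∀ i < m + 1, ∀ y : G,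
      (∃ j ≤ m + 1, ∃ k ∈ Subgroup.closure (r '' Set.Iio m),
        y = ascendingProd r j (m + 1 - j) * k) →
      ∃ j ≤ m + 1, ∃ k ∈ Subgroup.closure (r '' Set.Iio m),
        r i * y = ascendingProd r j (m + 1 - j) * k := by
    rintro i hi _ ⟨j, hj, k, hk, rfl⟩
    rcases lt_trichotomy i j with hij | rfl | hij
    · rcases (Nat.succ_le_of_lt hij).eq_or_lt with rfl | hij
      · refine ⟨i, by omega, k, hk, ?_⟩
        rw [show m + 1 - i = (m + 1 - i.succ) + 1 by omega, ascendingProd, mul_assoc]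
      · refine ⟨j, hj, r i * k,
          mul_mem (Subgroup.subset_closure ⟨i, by simp; omega, rfl⟩) hk, ?_⟩
        rw [← mul_assoc, h.mul_ascendingProd_of_lt i j _ (by omega) (by omega), mul_assoc]
    · refine ⟨i + 1, by omega, k, hk, ?_⟩
      rw [show m + 1 - i = (m + 1 - (i + 1)) + 1 by omega, ascendingProd, ← mul_assoc,
        ← mul_assoc, h.sq i hi, one_mul]
    · obtain ⟨l, rfl⟩ : ∃ l, i = l + 1 := ⟨i - 1, by omega⟩
      refine ⟨j, hj, r l * k,
        mul_mem (Subgroup.subset_closure ⟨l, by simp; omega, rfl⟩) hk, ?_⟩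
      rw [← mul_assoc, h.mul_ascendingProd_of_mem l j _ (by omega) (by omega) (by omega),
        mul_assoc]
  induction hx using Subgroup.closure_induction_left with
  | one => exact ⟨m + 1, le_rfl, 1, one_mem _, by simp [ascendingProd]⟩
  | mul_left x hx y _ ih =>
    obtain ⟨i, hi, rfl⟩ := hx
    exact step i hi y ih
  | inv_mul_cancel x hx y _ ih =>
    obtain ⟨i, hi, rfl⟩ := hx
    rw [inv_eq_of_mul_eq_one_right (h.sq i hi)]
    exact step i hi y ih

theorem finite_closure_and_card_le (h : IsCoxeterFamilyA m r) :
    Finite (Subgroup.closure (r '' Set.Iio m)) ∧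
      Nat.card (Subgroup.closure (r '' Set.Iio m)) ≤ (m + 1).factorial := by
  induction m with
  | zero => simp [Subgroup.closure_empty]; infer_instance
  | succ m ih =>
    obtain ⟨hfin, hcard⟩ := ih (h.mono (Nat.le_succ m))
    let f : Fin (m + 2) × Subgroup.closure (r '' Set.Iio m) → G :=
      fun p ↦ ascendingProd r p.1 (m + 1 - p.1) * p.2
    have hsub : (Subgroup.closure (r '' Set.Iio (m + 1)) : Set G) ⊆ Set.range f := by
      intro x hx
      obtain ⟨j, hj, k, hk, rfl⟩ := h.exists_eq_ascendingProd_mul hx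
      exact ⟨(⟨j, by omega⟩, ⟨k, hk⟩), rfl⟩
    refine ⟨(Set.finite_range f).subset hsub, ?_⟩
    calc Nat.card (Subgroup.closure (r '' Set.Iio (m + 1)))
        ≤ Nat.card (Set.range f) := Nat.card_mono (Set.finite_range f) hsub
      _ ≤ Nat.card (Fin (m + 2) × Subgroup.closure (r '' Set.Iio m)) := Finite.card_range_le f
      _ ≤ (m + 2).factorial := by
        rw [Nat.card_prod, Nat.card_fin, Nat.factorial_succ (m + 1)]
        exact Nat.mul_le_mul_left _ hcard

end IsCoxeterFamilyA

theorem swap_mul_swap_mul_swap_eq {α : Type*} [DecidableEq α] {a b c : α} (hac : a ≠ c)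
    (hbc : b ≠ c) : swap a b * swap b c * swap a b = swap a c := by
  rw [swap_comm a b, swap_comm b c, swap_mul_swap_mul_swap hbc.symm hac.symm]

theorem swap_braid {α : Type*} [DecidableEq α] {a b c : α} (hab : a ≠ b) (hac : a ≠ c)
    (hbc : b ≠ c) :
    swap a b * swap b c * swap a b = swap b c * swap a b * swap b c := by
  rw [swap_mul_swap_mul_swap_eq hac hbc, swap_mul_swap_mul_swap hab hac, swap_comm]

theorem swap_commute_of_disjoint {α : Type*} [DecidableEq α] {a b c d : α} (hac : a ≠ c)
    (had : a ≠ d) (hbc : b ≠ c) (hbd : b ≠ d) : swap a b * swap c d = swap c d * swap a b := by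
  rw [mul_swap_eq_swap_mul, swap_apply_of_ne_of_ne hac.symm hbc.symm,
    swap_apply_of_ne_of_ne had.symm hbd.symm]

/-- The presentation of the symmetric group by adjacent transpositions: a family that satisfies
the Coxeter relations is the image of the adjacent transpositions under a homomorphism. -/
theorem IsCoxeterFamilyA.exists_hom {G : Type*} [Group G] {m : ℕ} {r : ℕ → G}
    (h : IsCoxeterFamilyA m r) :
    ∃ f : Perm (Fin (m + 1)) →* G, ∀ i : Fin m, f (swap i.castSucc i.succ) = r i := by
  let s : ℕ → Perm (Fin (m + 1)) := fun i ↦ swap (Fin.ofNat _ i) (Fin.ofNat _ (i + 1))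
  have hs : ∀ i : Fin m, s i = swap i.castSucc i.succ := by
    intro i
    simp only [s]
    congr 1 <;> ext <;> simp [Nat.mod_eq_of_lt, i.2]
  have hne : ∀ i j : ℕ, i < m + 1 → j < m + 1 → i ≠ j →
      (Fin.ofNat (m + 1) i) ≠ Fin.ofNat (m + 1) j := by
    intro i j hi hj hij
    simp [Fin.ext_iff, Nat.mod_eq_of_lt, hi, hj, hij]
  -- The pairs generate the graph of the desired map. The order bound applies to this subgroup of
  -- the product, which also surjects onto the symmetric group; so its second projection is an
  -- isomorphism, and the first projection composed with the inverse is the map.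
  have hfam : IsCoxeterFamilyA m (fun i ↦ (r i, s i)) := by
    refine ⟨fun i hi ↦ ?_, fun i hi ↦ ?_, fun i j hij hj ↦ ?_⟩
    · exact Prod.ext (h.sq i hi) (swap_mul_self _ _)
    · refine Prod.ext (h.braid i hi) ?_
      have h1 := hne i (i + 1) (by omega) (by omega) (by omega)
      have h2 := hne i (i + 1 + 1) (by omega) (by omega) (by omega)
      have h3 := hne (i + 1) (i + 1 + 1) (by omega) (by omega) (by omega)
      exact swap_braid h1 h2 h3
    · refine Prod.ext (h.comm i j hij hj) ?_
      exact swap_commute_of_disjoint (hne _ _ (by omega) (by omega) (by omega))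
        (hne _ _ (by omega) (by omega) (by omega)) (hne _ _ (by omega) (by omega) (by omega))
        (hne _ _ (by omega) (by omega) (by omega))
  obtain ⟨hfin, hcard⟩ := hfam.finite_closure_and_card_le
  set Γ := Subgroup.closure ((fun i ↦ (r i, s i)) '' Set.Iio m) with hΓ
  have hmem : ∀ i : Fin m, (r i, s i) ∈ Γ := fun i ↦ Subgroup.subset_closure ⟨i, i.2, rfl⟩
  let p : Γ →* Perm (Fin (m + 1)) := (MonoidHom.snd G _).comp Γ.subtype
  have hp : Function.Surjective p := by
    rw [← MonoidHom.range_eq_top, eq_top_iff, ← Subgroup.toSubmonoid_le, Subgroup.top_toSubmonoid,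
      ← mclosure_swap_castSucc_succ, Submonoid.closure_le]
    rintro _ ⟨i, rfl⟩
    exact ⟨⟨_, hmem i⟩, hs i⟩
  have hbij : Function.Bijective p := by
    refine (Function.Surjective.bijective_of_nat_card_le hp ?_)
    simpa [Fintype.card_perm] using hcard
  let e := MulEquiv.ofBijective p hbij
  refine ⟨((MonoidHom.fst G _).comp Γ.subtype).comp e.symm.toMonoidHom, fun i ↦ ?_⟩
  have : e.symm (swap i.castSucc i.succ) = ⟨_, hmem i⟩ := by
    rw [MulEquiv.symm_apply_eq]
    exact (hs i).symm
  simp [this]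

/-- A homomorphism out of a symmetric group on at least five letters is injective, or takes the
same value on all transpositions. -/
theorem injective_or_map_isSwap_eq {α : Type*} [Fintype α] [DecidableEq α] {G : Type*} [Group G]
    (hα : 5 ≤ Nat.card α) (f : Perm α →* G) :
    Function.Injective f ∨ ∀ x y : Perm α, x.IsSwap → y.IsSwap → f x = f y := by
  by_cases hk : f.ker = ⊥
  · exact Or.inl ((MonoidHom.ker_eq_bot_iff f).1 hk)
  · refine Or.inr fun x y hx hy ↦ ?_
    have hle := alternatingGroup_le_of_normal hα ((Subgroup.nontrivial_iff_ne_bot _).2 hk)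
    have hxy : f (x * y) = 1 := hle (mul_mem_alternatingGroup_of_isSwap hx hy)
    have hyy : f (y * y) = 1 := hle (mul_mem_alternatingGroup_of_isSwap hy hy)
    rw [map_mul] at hxy hyy
    exact mul_right_cancel (hxy.trans hyy.symm)

/-! ### Automorphisms that preserve transpositions -/

section SwapPreserving

variable {X : Type*} [DecidableEq X]

theorem exists_common_point_of_not_commute {x y : Perm X} (hx : x.IsSwap) (hy : y.IsSwap)
    (hxy : x * y ≠ y * x) : ∃ v p q, v ≠ p ∧ v ≠ q ∧ p ≠ q ∧ x = swap v p ∧ y = swap v q := by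
  obtain ⟨a, b, hab, rfl⟩ := hx
  obtain ⟨c, d, hcd, rfl⟩ := hy
  by_cases hac : a = c
  · subst hac
    exact ⟨a, b, d, hab, hcd, fun h ↦ hxy (by rw [h]), rfl, rfl⟩
  by_cases had : a = d
  · subst had
    exact ⟨a, b, c, hab, hcd.symm, fun h ↦ hxy (by rw [h, swap_comm]), rfl, swap_comm _ _⟩
  by_cases hbc : b = c
  · subst hbc
    exact ⟨b, a, d, hab.symm, hcd, had, swap_comm _ _, rfl⟩
  by_cases hbd : b = d
  · subst hbd
    exact ⟨b, a, c, hab.symm, hcd.symm, hac, swap_comm _ _, swap_comm _ _⟩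
  exact absurd (swap_commute_of_disjoint hac had hbc hbd) hxy

theorem swap_mul_swap_ne {a b c : X} (hab : a ≠ b) (hac : a ≠ c) (hbc : b ≠ c) :
    swap a b * swap a c ≠ swap a c * swap a b := by
  intro h
  have := congrArg (fun f : Perm X ↦ f a) h
  simp only [Perm.mul_apply, swap_apply_left, swap_apply_of_ne_of_ne hac.symm hbc.symm,
    swap_apply_of_ne_of_ne hab.symm hbc] at this
  exact hbc this.symm

theorem swap_mul_swap_pow_six {x y : Perm X} (hx : x.IsSwap) (hy : y.IsSwap) :
    (x * y) ^ 6 = 1 := by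
  have hxx : x * x = 1 := by obtain ⟨a, b, -, rfl⟩ := hx; exact swap_mul_self a b
  have hyy : y * y = 1 := by obtain ⟨a, b, -, rfl⟩ := hy; exact swap_mul_self a b
  by_cases hxy : x * y = y * x
  · have : (x * y) ^ 2 = 1 := by
      rw [pow_two]; nth_rw 2 [hxy]; rw [mul_assoc, ← mul_assoc y, hyy, one_mul, hxx]
    rw [show 6 = 2 * 3 from rfl, pow_mul, this, one_pow]
  · obtain ⟨v, p, q, hvp, hvq, hpq, rfl, rfl⟩ := exists_common_point_of_not_commute hx hy hxy
    have hb := swap_braid hvp.symm hpq hvq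
    rw [swap_comm p v] at hb
    have : (swap v p * swap v q) ^ 3 = 1 := by
      calc (swap v p * swap v q) ^ 3
          = (swap v p * swap v q * swap v p) * (swap v q * swap v p * swap v q) := by
            simp only [pow_succ, pow_zero, one_mul, mul_assoc]
        _ = 1 := by
          rw [← hb]
          simp only [mul_assoc, swap_mul_self_mul, swap_mul_self]
    rw [show 6 = 3 * 2 from rfl, pow_mul, this, one_pow]

/-- The transpositions that move `a` pairwise fail to commute, so their images are pairwise meeting
edges: a star or a triangle. The rest of the proof excludes the triangle. -/
theorem MulAut.exists_common_point (α : MulAut (Perm X)) (hX : ∀ a b : X, ∃ c, c ≠ a ∧ c ≠ b)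
    (hα : ∀ a b : X, a ≠ b → (α (swap a b)).IsSwap) (a : X) :
    ∃ v, ∀ b, b ≠ a → α (swap a b) v ≠ v := by
  obtain ⟨b, hba, -⟩ := hX a a
  obtain ⟨c, hca, hcb⟩ := hX a b
  have hnc : ∀ b c, b ≠ a → c ≠ a → c ≠ b →
      α (swap a b) * α (swap a c) ≠ α (swap a c) * α (swap a b) := by
    intro b c hba hca hcb h
    rw [← map_mul, ← map_mul] at h
    exact swap_mul_swap_ne hba.symm hca.symm hcb.symm (α.injective h)
  obtain ⟨v, p, q, hvp, hvq, hpq, hb, hc⟩ := exists_common_point_of_not_commute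
    (hα a b hba.symm) (hα a c hca.symm) (hnc b c hba hca hcb)
  refine ⟨v, fun d hda ↦ ?_⟩
  by_cases hdb : d = b
  · subst hdb; rw [hb, swap_apply_left]; exact hvp.symm
  by_cases hdc : d = c
  · subst hdc; rw [hc, swap_apply_left]; exact hvq.symm
  intro hv
  have h1 := hnc b d hba hda hdb
  have h2 := hnc c d hca hda hdc
  obtain ⟨e, f, hef, hd⟩ := hα a d hda.symm
  rw [hb, hd] at h1
  rw [hc, hd] at h2
  have hve : v ≠ e := by
    rintro rfl; rw [hd, swap_apply_left] at hv; exact hef hv.symm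
  have hvf : v ≠ f := by
    rintro rfl; rw [hd, swap_apply_right] at hv; exact hef hv
  have hpef : p = e ∨ p = f := by
    by_contra! h; exact h1 (swap_commute_of_disjoint hve hvf h.1 h.2)
  have hqef : q = e ∨ q = f := by
    by_contra! h; exact h2 (swap_commute_of_disjoint hve hvf h.1 h.2)
  have hpq' : swap e f = swap p q := by
    rcases hpef with rfl | rfl <;> rcases hqef with rfl | rfl
    · exact absurd rfl hpq
    · rfl
    · exact swap_comm _ _
    · exact absurd rfl hpq
  -- The third side of a triangle is a conjugate of one of the other two by the other, hence also
  -- the image of `swap b c`.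
  have key : α (swap b c) = α (swap a d) := by
    rw [hd, hpq', ← swap_mul_swap_mul_swap_eq hpq hvq, swap_comm p v, ← hb, ← hc, ← map_mul,
      ← map_mul, swap_comm a b, swap_mul_swap_mul_swap_eq hcb.symm hca.symm]
  have := congrArg (fun f : Perm X ↦ f d) (α.injective key)
  simp only [swap_apply_right, swap_apply_of_ne_of_ne hdb hdc] at this
  exact hda this

theorem MulAut.ext_of_swap [Finite X] {α β : MulAut (Perm X)}
    (h : ∀ a b : X, a ≠ b → α (swap a b) = β (swap a b)) : α = β := by
  have : α.toMonoidHom = β.toMonoidHom := by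
    refine MonoidHom.eq_of_eqOn_dense closure_isSwap ?_
    rintro _ ⟨a, b, hab, rfl⟩
    exact h a b hab
  exact MulEquiv.ext fun x ↦ DFunLike.congr_fun this x

/-- The conjugating permutation sends `a` to the centre `v a` of its star. If `v a = v b`, then
`swap b c`, a conjugate of `swap a c` by `swap a b`, would have an image fixing that point. -/
theorem MulAut.exists_eq_conj_of_isSwap [Finite X] (α : MulAut (Perm X))
    (hX : ∀ a b : X, ∃ c, c ≠ a ∧ c ≠ b)
    (hα : ∀ a b : X, a ≠ b → (α (swap a b)).IsSwap) : ∃ g : Perm X, α = MulAut.conj g := by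
  choose v hv using MulAut.exists_common_point α hX hα
  have hinj : Function.Injective v := by
    intro a b hab
    by_contra hne
    obtain ⟨c, hca, hcb⟩ := hX a b
    have h1 := hv a b (Ne.symm hne)
    have h2 := hv a c hca
    have h3 := hv b c hcb
    have moved : ∀ x y, x ≠ y → α (swap x y) (v a) ≠ v a →
        ∃ p, p ≠ v a ∧ α (swap x y) = swap (v a) p := by
      intro x y hxy hm
      obtain ⟨e, f, hef, h⟩ := hα x y hxy
      rw [h] at hm ⊢
      rcases (swap_apply_ne_self_iff.1 hm).2 with h | h
      · exact ⟨f, by rw [h]; exact hef.symm, by rw [h]⟩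
      · exact ⟨e, by rw [h]; exact hef, by rw [h, swap_comm]⟩
    obtain ⟨p, hp, hp'⟩ := moved a b hne h1
    obtain ⟨q, hq, hq'⟩ := moved a c hca.symm h2
    rw [← hab] at h3
    have hpq : p ≠ q := by
      rintro rfl
      have := congrArg (fun f : Perm X ↦ f b) (α.injective (hp'.trans hq'.symm))
      simp only [swap_apply_right, swap_apply_of_ne_of_ne (Ne.symm hne) hcb.symm] at this
      exact hne this
    apply h3
    rw [← swap_mul_swap_mul_swap_eq hcb.symm hca.symm, swap_comm b a, map_mul, map_mul, hp', hq',
      swap_comm (v a) p, swap_mul_swap_mul_swap_eq hpq hq.symm,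
      swap_apply_of_ne_of_ne hp.symm hq.symm]
  refine ⟨Equiv.ofBijective v hinj.bijective_of_finite, MulAut.ext_of_swap fun a b hab ↦ ?_⟩
  rw [MulAut.conj_apply, ← swap_apply_apply, Equiv.ofBijective_apply, Equiv.ofBijective_apply]
  have h1 := hv a b hab.symm
  have h2 := hv b a hab
  obtain ⟨e, f, hef, h⟩ := hα a b hab
  rw [swap_comm b a] at h2
  rw [h] at h1 h2 ⊢
  have hvab : v a ≠ v b := fun h ↦ hab (hinj h)
  rcases (swap_apply_ne_self_iff.1 h1).2 with h1 | h1 <;>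
    rcases (swap_apply_ne_self_iff.1 h2).2 with h2 | h2
  · exact absurd (h1.trans h2.symm) hvab
  · rw [h1, h2]
  · rw [h1, h2, swap_comm]
  · exact absurd (h1.trans h2.symm) hvab

end SwapPreserving

/-! ### Involutions other than transpositions -/

section Involution

variable {X : Type*}

/-- Reduces the search for `g` to a computation on an invariant set of few letters; `g₀` is extended
by the identity. -/
theorem exists_conj_pow_ne_one_of_embedding {ι : Type*} (f : ι ↪ X) {x : Perm X}
    {x₀ g₀ : Perm ι} (hx : ∀ i, x (f i) = f (x₀ i)) {k : ℕ}
    (h : (x₀ * (g₀ * x₀ * g₀⁻¹)) ^ k ≠ 1) : ∃ g : Perm X, (x * (g * x * g⁻¹)) ^ k ≠ 1 := by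
  have hg : ∀ (σ : Perm ι) i, (σ.viaEmbedding f) (f i) = f (σ i) :=
    fun σ i ↦ σ.viaEmbedding_apply f i
  refine ⟨g₀.viaEmbedding f, fun hone ↦ h ?_⟩
  have hinv : ∀ i, (g₀.viaEmbedding f)⁻¹ (f i) = f (g₀⁻¹ i) := by
    intro i
    rw [inv_eq_iff_eq, hg]; simp
  have hpow : ∀ (l : ℕ) i, ((x * (g₀.viaEmbedding f * x * (g₀.viaEmbedding f)⁻¹)) ^ l) (f i) =
      f (((x₀ * (g₀ * x₀ * g₀⁻¹)) ^ l) i) := by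
    intro l
    induction l with
    | zero => simp
    | succ l ih =>
      intro i
      simp only [pow_succ, Perm.mul_apply, hinv, hx, hg] at ih ⊢
      exact ih _
  ext i
  apply f.injective
  rw [← hpow, hone]
  rfl

variable [DecidableEq X] {x : Perm X}

theorem exists_two_moved_points (hx1 : x ≠ 1) (hx : ¬ x.IsSwap) (hinv : x * x = 1) :
    ∃ a b, x a ≠ a ∧ x b ≠ b ∧ b ≠ a ∧ b ≠ x a := by
  have hxx : ∀ i, x (x i) = i := fun i ↦ DFunLike.congr_fun hinv i
  obtain ⟨a, ha⟩ : ∃ a, x a ≠ a := by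
    by_contra! h
    exact hx1 (Perm.ext h)
  by_contra! h
  refine hx ⟨a, x a, ha.symm, Perm.ext fun b ↦ ?_⟩
  by_cases hba : b = a
  · rw [hba, swap_apply_left]
  by_cases hbx : b = x a
  · rw [hbx, swap_apply_right, hxx]
  · rw [swap_apply_of_ne_of_ne hba hbx]
    by_contra hb
    exact hbx (h a b ha hb hba)

-- Two 2-cycles and a fixed point suffice: `(0 1)(2 3)` times its rotation `(1 2)(3 4)` is a
-- 5-cycle.
set_option maxRecDepth 4000 in
theorem exists_conj_pow_six_ne_one_of_fixed (hx1 : x ≠ 1) (hx : ¬ x.IsSwap) (hinv : x * x = 1)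
    {e : X} (he : x e = e) : ∃ g : Perm X, (x * (g * x * g⁻¹)) ^ 6 ≠ 1 := by
  have hxx : ∀ i, x (x i) = i := fun i ↦ DFunLike.congr_fun hinv i
  obtain ⟨a, b, ha, hb, hba, hbx⟩ := exists_two_moved_points hx1 hx hinv
  have hnd : [a, x a, b, x b, e].Nodup := by
    simp only [List.nodup_cons, List.mem_cons, List.not_mem_nil, not_or]
    grind
  refine exists_conj_pow_ne_one_of_embedding (ι := Fin 5)
    (x₀ := swap 0 1 * swap 2 3) (g₀ := finRotate 5)
    ⟨[a, x a, b, x b, e].get, List.nodup_iff_injective_get.1 hnd⟩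
    (fun i ↦ ?_) (fun h ↦ absurd (DFunLike.congr_fun h 0) (by decide))
  fin_cases i
  · rfl
  · exact hxx a
  · rfl
  · exact hxx b
  · exact he

-- At least five letters yield a third 2-cycle, and a number other than six a fourth. Four 2-cycles
-- times their rotation by one step form two 4-cycles.
set_option maxRecDepth 4000 in
theorem exists_conj_pow_six_ne_one_of_fixedPointFree [Fintype X] (hX : 5 ≤ Fintype.card X)
    (hX6 : Fintype.card X ≠ 6) (hx : ¬ x.IsSwap) (hinv : x * x = 1) (hfpf : ∀ i, x i ≠ i) :
    ∃ g : Perm X, (x * (g * x * g⁻¹)) ^ 6 ≠ 1 := by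
  have hxx : ∀ i, x (x i) = i := fun i ↦ DFunLike.congr_fun hinv i
  have hx1 : x ≠ 1 := by
    rintro rfl
    have : Nonempty X := Fintype.card_pos_iff.1 (by omega)
    exact hfpf (Classical.arbitrary X) rfl
  have hout : ∀ l : List X, l.Nodup → l.length ≤ Fintype.card X → l.length ≠ Fintype.card X →
      ∃ c, c ∉ l := by
    intro l hl hle hne
    by_contra! h
    apply hne
    rw [← List.toFinset_card_of_nodup hl, ← Finset.card_univ]
    congr 1
    ext c
    simp [h c]
  obtain ⟨a, b, ha, hb, hba, hbx⟩ := exists_two_moved_points hx1 hx hinv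
  have hnd4 : [a, x a, b, x b].Nodup := by
    simp only [List.nodup_cons, List.mem_cons, List.not_mem_nil, not_or]
    grind
  obtain ⟨c, hc⟩ := hout _ hnd4 (by simp; omega) (by simp; omega)
  have hnd6 : [a, x a, b, x b, c, x c].Nodup := by
    have := hfpf c
    simp only [List.nodup_cons, List.mem_cons, List.not_mem_nil, not_or] at hc hnd4 ⊢
    grind
  have hcard := List.Nodup.length_le_card hnd6
  obtain ⟨d, hd⟩ := hout _ hnd6 hcard (by simp; omega)
  have hnd8 : [a, x a, b, x b, c, x c, d, x d].Nodup := by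
    have := hfpf d
    simp only [List.nodup_cons, List.mem_cons, List.not_mem_nil, not_or] at hd hnd6 ⊢
    grind
  refine exists_conj_pow_ne_one_of_embedding (ι := Fin 8)
    (x₀ := swap 0 1 * swap 2 3 * swap 4 5 * swap 6 7) (g₀ := finRotate 8)
    ⟨[a, x a, b, x b, c, x c, d, x d].get, List.nodup_iff_injective_get.1 hnd8⟩
    (fun i ↦ ?_) (fun h ↦ absurd (DFunLike.congr_fun h 0) (by decide))
  fin_cases i
  · rfl
  · exact hxx a
  · rfl
  · exact hxx b
  · rfl
  · exact hxx c
  · rfl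
  · exact hxx d

/-- Two involutions without fixed points are conjugate. -/
theorem isConj_of_fixedPointFree [Fintype X] {y : Perm X} (hx : x * x = 1) (hy : y * y = 1)
    (hx' : ∀ i, x i ≠ i) (hy' : ∀ i, y i ≠ i) : IsConj x y := by
  have key : ∀ z : Perm X, z * z = 1 → (∀ i, z i ≠ i) →
      z.cycleType = Multiset.replicate (Fintype.card X / 2) 2 := by
    intro z hz hz'
    have h1 := cycleType_of_pow_prime_eq_one (p := 2) (σ := z) (by rw [pow_two, hz])
    have hs : z.support = Finset.univ := by ext i; simp [hz' i]
    have h2 := z.sum_cycleType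
    rw [h1, hs, Multiset.sum_replicate, Finset.card_univ] at h2
    rw [h1]
    congr 1
    simp at h2
    omega
  rw [isConj_iff_cycleType_eq, key x hx hx', key y hy hy']

end Involution

/-! ### Automorphisms of symmetric groups -/

section Automorphism

variable {X : Type*} [DecidableEq X] [Fintype X]

/-- An automorphism of a symmetric group on at least five letters preserves transpositions, except
perhaps on six letters, where it may turn them into involutions without fixed points. -/
theorem MulAut.isSwap_or_fixedPointFree (hX : 5 ≤ Fintype.card X) (α : MulAut (Perm X))
    {s : Perm X} (hs : s.IsSwap) :
    (α s).IsSwap ∨ (Fintype.card X = 6 ∧ ∀ i, α s i ≠ i) := by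
  by_contra! hcon
  obtain ⟨hns, hcon⟩ := hcon
  have hss : s * s = 1 := by obtain ⟨a, b, -, rfl⟩ := hs; exact swap_mul_self a b
  have hs1 : s ≠ 1 := by
    obtain ⟨a, b, hab, rfl⟩ := hs
    exact fun h ↦ hab (swap_eq_one_iff.1 h)
  have hinv : α s * α s = 1 := by rw [← map_mul, hss, map_one]
  have hne : α s ≠ 1 := fun h ↦ hs1 (α.injective (h.trans (map_one α).symm))
  -- As `g` is itself a value of `α`, this product is the image of a product of two transpositions.
  have hpow : ∀ g : Perm X, (α s * (g * α s * g⁻¹)) ^ 6 = 1 := by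
    intro g
    obtain ⟨g, rfl⟩ := α.surjective g
    rw [← map_inv, ← map_mul, ← map_mul, ← map_mul, ← map_pow, swap_mul_swap_pow_six hs, map_one]
    obtain ⟨a, b, hab, rfl⟩ := hs
    exact ⟨g a, g b, fun h ↦ hab (g.injective h), (swap_apply_apply g a b).symm⟩
  by_cases h6 : Fintype.card X = 6
  · obtain ⟨e, he⟩ := hcon h6
    obtain ⟨g, hg⟩ := exists_conj_pow_six_ne_one_of_fixed hne hns hinv he
    exact hg (hpow g)
  · by_cases hf : ∃ e, α s e = e
    · obtain ⟨e, he⟩ := hf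
      obtain ⟨g, hg⟩ := exists_conj_pow_six_ne_one_of_fixed hne hns hinv he
      exact hg (hpow g)
    · push Not at hf
      obtain ⟨g, hg⟩ := exists_conj_pow_six_ne_one_of_fixedPointFree hX h6 hns hinv hf
      exact hg (hpow g)

theorem exists_ne_and_ne (hX : 3 ≤ Fintype.card X) (a b : X) : ∃ c, c ≠ a ∧ c ≠ b := by
  by_contra! h
  have : (Finset.univ : Finset X) ⊆ {a, b} := by
    intro c _
    simp only [Finset.mem_insert, Finset.mem_singleton]
    exact or_iff_not_imp_left.2 (h c)
  have := (Finset.card_le_card this).trans Finset.card_le_two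
  rw [Finset.card_univ] at this
  omega

/-- An automorphism of a symmetric group that takes one transposition to a transposition is
inner. -/
theorem MulAut.exists_eq_conj_of_exists_isSwap (hX : 3 ≤ Fintype.card X) (α : MulAut (Perm X))
    {s : Perm X} (hs : s.IsSwap) (hαs : (α s).IsSwap) : ∃ g : Perm X, α = MulAut.conj g := by
  refine MulAut.exists_eq_conj_of_isSwap α (exists_ne_and_ne hX) fun a b hab ↦ ?_
  obtain ⟨c, d, hcd, rfl⟩ := hs
  obtain ⟨g, hg⟩ := isConj_iff.1 (isConj_swap hcd hab)
  obtain ⟨e, f, hef, hαs⟩ := hαs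
  rw [← hg, map_mul, map_mul, map_inv, hαs, ← swap_apply_apply]
  exact ⟨_, _, fun h ↦ hef ((α g).injective h), rfl⟩

/-- Automorphisms of a symmetric group on at least five letters, but not on six, are inner. -/
theorem MulAut.exists_eq_conj (hX : 5 ≤ Fintype.card X) (hX6 : Fintype.card X ≠ 6)
    (α : MulAut (Perm X)) : ∃ g : Perm X, α = MulAut.conj g := by
  obtain ⟨a, b, hab⟩ := Fintype.exists_pair_of_one_lt_card (α := X) (by omega)
  have hs : (swap a b).IsSwap := ⟨a, b, hab, rfl⟩
  refine MulAut.exists_eq_conj_of_exists_isSwap (by omega) α hs ?_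
  exact (MulAut.isSwap_or_fixedPointFree hX α hs).resolve_right fun h ↦ hX6 h.1

theorem IsNonInner.inv {G : Type*} [Group G] {ν : MulAut G} (h : IsNonInner ν) :
    IsNonInner ν⁻¹ := by
  rintro ⟨g, hg⟩
  exact h ⟨g⁻¹, by rw [map_inv, ← hg, inv_inv]⟩

/-- The outer automorphism group of a symmetric group has at most two elements. -/
theorem IsNonInner.exists_mul_eq_conj (hX : 5 ≤ Fintype.card X) {μ ν : MulAut (Perm X)}
    (hμ : IsNonInner μ) (hν : IsNonInner ν) : ∃ g : Perm X, μ * ν = MulAut.conj g := by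
  obtain ⟨a, b, hab⟩ := Fintype.exists_pair_of_one_lt_card (α := X) (by omega)
  have hs : (swap a b).IsSwap := ⟨a, b, hab, rfl⟩
  have key : ∀ {ξ : MulAut (Perm X)}, IsNonInner ξ → ∀ i, ξ (swap a b) i ≠ i := by
    intro ξ hξ
    exact ((MulAut.isSwap_or_fixedPointFree hX ξ hs).resolve_left fun h ↦
      hξ (MulAut.exists_eq_conj_of_exists_isSwap (by omega) ξ hs h)).2
  have hsq : ∀ ξ : MulAut (Perm X), ξ (swap a b) * ξ (swap a b) = 1 := fun ξ ↦ by
    rw [← map_mul, swap_mul_self, map_one]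
  -- Since `ν s` is conjugate to `μ⁻¹ s`, applying `μ` gives a conjugate of `s`, where `s` is `swap
  -- a b`.
  obtain ⟨g, hg⟩ := isConj_iff.1
    (isConj_of_fixedPointFree (hsq μ⁻¹) (hsq ν) (key hμ.inv) (key hν))
  refine MulAut.exists_eq_conj_of_exists_isSwap (by omega) (μ * ν) hs ?_
  rw [MulAut.mul_apply, ← hg, map_mul, map_mul, map_inv, MulAut.apply_inv_self, ← swap_apply_apply]
  exact ⟨_, _, fun h ↦ hab ((μ g).injective h), rfl⟩

/-- The images of the adjacent transpositions under an exceptional automorphism of the symmetric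
group on six letters. -/
def exceptionalFamily : ℕ → Perm (Fin 6)
  | 0 => swap 0 1 * swap 2 3 * swap 4 5
  | 1 => swap 0 2 * swap 1 4 * swap 3 5
  | 2 => swap 0 1 * swap 2 5 * swap 3 4
  | 3 => swap 0 2 * swap 1 3 * swap 4 5
  | _ => swap 0 1 * swap 2 4 * swap 3 5

theorem isCoxeterFamilyA_exceptionalFamily : IsCoxeterFamilyA 5 exceptionalFamily where
  sq i hi := by interval_cases i <;> decide
  braid i hi := by
    have : i < 4 := by omega
    interval_cases i <;> decide
  comm i j hij hj := by
    have : i < 3 := by omega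
    interval_cases j <;> interval_cases i <;> first | omega | decide

theorem exists_isNonInner_perm_six : ∃ ν : MulAut (Perm (Fin 6)), IsNonInner ν := by
  obtain ⟨f, hf⟩ := isCoxeterFamilyA_exceptionalFamily.exists_hom
  have h0 : f (swap 0 1) = exceptionalFamily 0 := hf 0
  have h1 : f (swap 1 2) = exceptionalFamily 1 := hf 1
  have hinj : Function.Injective f := by
    refine (injective_or_map_isSwap_eq (by simp) f).resolve_right fun h ↦ ?_
    have := h (swap 0 1) (swap 1 2) ⟨0, 1, by decide, rfl⟩ ⟨1, 2, by decide, rfl⟩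
    rw [h0, h1] at this
    exact absurd this (by decide)
  refine ⟨MulEquiv.ofBijective f hinj.bijective_of_finite, ?_⟩
  rintro ⟨g, hg⟩
  have h := DFunLike.congr_fun hg (swap 0 1)
  rw [MulEquiv.ofBijective_apply, h0, MulAut.conj_apply, ← swap_apply_apply] at h
  have hfree : ∀ i, exceptionalFamily 0 i ≠ i := by decide
  -- A conjugate of `swap 0 1` by `g` fixes `g 2`, whereas the image of `swap 0 1` fixes nothing.
  apply hfree (g 2)
  rw [h, swap_apply_of_ne_of_ne (by simp) (by simp)]

end Automorphism

/-! ### Homomorphisms to and from the welded group -/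

namespace UW

variable {n c : ℕ}

/-- The image of the generator `ρ i` in `UW_n(c)`. -/
def rho (i : Fin (n - 1)) : UW n c := QuotientGroup.mk (UV.rho i)

/-- The image of the generator `σ i t` in `UW_n(c)`. -/
def sigma (i : Fin (n - 1)) (t : Fin c) : UW n c := QuotientGroup.mk (UV.sigma i t)

theorem mk_eq_mk_of_rel {x y : FreeGroup (UVGen n c)} (h : UVRel n c (x * y⁻¹)) :
    (QuotientGroup.mk (PresentedGroup.mk {w | UVRel n c w} x) : UW n c) =
      QuotientGroup.mk (PresentedGroup.mk {w | UVRel n c w} y) := by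
  have := PresentedGroup.one_of_mem (rels := {w | UVRel n c w}) h
  rw [map_mul, map_inv, mul_inv_eq_one] at this
  rw [this]

theorem rho_braid {i j : Fin (n - 1)} (h : (j : ℕ) = i + 1) :
    (rho i * rho j * rho i : UW n c) = rho j * rho i * rho j :=
  mk_eq_mk_of_rel (UVRel.pr1 i j h)

theorem rho_mul_rho {i j : Fin (n - 1)} (h : 2 ≤ |(i : ℤ) - (j : ℤ)|) :
    (rho i * rho j : UW n c) = rho j * rho i :=
  mk_eq_mk_of_rel (UVRel.pr2 i j h)

theorem rho_mul_self (i : Fin (n - 1)) : (rho i * rho i : UW n c) = 1 := by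
  rw [← pow_two]
  refine mk_eq_mk_of_rel (y := 1) ?_
  rw [inv_one, mul_one]
  exact UVRel.pr3 i

theorem sigma_mul_sigma {i j : Fin (n - 1)} (t l : Fin c) (h : 2 ≤ |(i : ℤ) - (j : ℤ)|) :
    (sigma i t * sigma j l : UW n c) = sigma j l * sigma i t :=
  mk_eq_mk_of_rel (UVRel.cr i j t l h)

theorem sigma_mul_rho {i j : Fin (n - 1)} (t : Fin c) (h : 2 ≤ |(i : ℤ) - (j : ℤ)|) :
    (sigma i t * rho j : UW n c) = rho j * sigma i t :=
  mk_eq_mk_of_rel (UVRel.mr1 i j t h)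

theorem rho_mul_rho_mul_sigma {i j : Fin (n - 1)} (t : Fin c) (h : (j : ℕ) = i + 1) :
    (rho i * rho j * sigma i t : UW n c) = sigma j t * rho i * rho j :=
  mk_eq_mk_of_rel (UVRel.mr2 i j t h)

theorem welded {i j : Fin (n - 1)} (t : Fin c) (h : (j : ℕ) = i + 1) :
    (rho i * sigma j t * sigma i t : UW n c) = sigma j t * sigma i t * rho j := by
  rw [← mul_inv_eq_one]
  exact (QuotientGroup.eq_one_iff _).2 (Subgroup.subset_normalClosure ⟨i, j, t, h, rfl⟩)

theorem hom_ext {G : Type*} [Group G] {φ ψ : UW n c →* G} (hr : ∀ i, φ (rho i) = ψ (rho i))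
    (hs : ∀ i t, φ (sigma i t) = ψ (sigma i t)) : φ = ψ := by
  refine QuotientGroup.monoidHom_ext _ (PresentedGroup.ext fun x ↦ ?_)
  cases x with
  | rho i => exact hr i
  | sigma i t => exact hs i t

theorem eq_top_of_mem {H : Subgroup (UW n c)} (hr : ∀ i, rho i ∈ H) (hs : ∀ i t, sigma i t ∈ H) :
    H = ⊤ := by
  have h : (H.comap (QuotientGroup.mk' _)) = (⊤ : Subgroup (UV n c)) := by
    rw [eq_top_iff, ← PresentedGroup.closure_range_of, Subgroup.closure_le]
    rintro _ ⟨x, rfl⟩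
    cases x with
    | rho i => exact hr i
    | sigma i t => exact hs i t
  rw [eq_top_iff]
  intro x _
  obtain ⟨y, rfl⟩ := QuotientGroup.mk_surjective x
  have : y ∈ H.comap (QuotientGroup.mk' _) := h ▸ Subgroup.mem_top y
  exact this

/-- A family of group elements with the Coxeter relations of type `A` extends to a homomorphism
from `UW_n(c)` that does not tell `σ i t` from `ρ i`. -/
theorem exists_hom_of_family {G : Type*} [Group G] {s : Fin (n - 1) → G}
    (hsq : ∀ i, s i * s i = 1)
    (hbraid : ∀ i j : Fin (n - 1), (j : ℕ) = i + 1 → s i * s j * s i = s j * s i * s j)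
    (hcomm : ∀ i j : Fin (n - 1), 2 ≤ |(i : ℤ) - (j : ℤ)| → s i * s j = s j * s i) :
    ∃ π : UW n c →* G, (∀ i, π (rho i) = s i) ∧ ∀ i t, π (sigma i t) = s i := by
  let f : UVGen n c → G
    | .rho i => s i
    | .sigma i _ => s i
  have hf : ∀ w ∈ {w | UVRel n c w}, FreeGroup.lift f w = 1 := by
    rintro w (⟨i, j, h⟩ | ⟨i, j, h⟩ | ⟨i⟩ | ⟨i, j, t, l, h⟩ | ⟨i, j, t, h⟩ | ⟨i, j, t, h⟩) <;>
      simp only [map_mul, map_inv, map_pow, mul_inv_eq_one, UVGen.r, UVGen.s,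
        FreeGroup.lift_apply_of, f]
    · exact hbraid i j h
    · exact hcomm i j h
    · rw [pow_two, hsq]
    · exact hcomm i j h
    · exact hcomm i j h
    · exact hbraid i j h
  have hker : ∀ x ∈ Subgroup.normalClosure (UV.weldedRelators n c),
      PresentedGroup.toGroup hf x = 1 := by
    intro x hx
    suffices Subgroup.normalClosure (UV.weldedRelators n c) ≤ (PresentedGroup.toGroup hf).ker from
      this hx
    refine Subgroup.normalClosure_le_normal ?_
    rintro _ ⟨i, j, t, h, rfl⟩
    simp only [SetLike.mem_coe, MonoidHom.mem_ker, map_mul, map_inv, mul_inv_eq_one, UV.rho,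
      UV.sigma, PresentedGroup.toGroup.of, f]
    exact hbraid i j h
  exact ⟨QuotientGroup.lift _ (PresentedGroup.toGroup hf) hker,
    fun i ↦ PresentedGroup.toGroup.of hf, fun i t ↦ PresentedGroup.toGroup.of hf⟩

/-- A homomorphism that takes the same value on all `ρ i` has abelian image. -/
theorem commute_of_map_rho_eq (hn : 5 ≤ n) {G : Type*} [Group G] (ψ : UW n c →* G)
    (h : ∀ i j, ψ (rho i) = ψ (rho j)) (x y : UW n c) : ψ x * ψ y = ψ y * ψ x := by
  -- With all `ρ` equal to one involution, the mixed relation cancels to an equality of neighbouring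
  -- `σ`.
  have hstep : ∀ (i j : Fin (n - 1)) (t : Fin c), (j : ℕ) = i + 1 →
      ψ (sigma j t) = ψ (sigma i t) := by
    intro i j t hij
    have h1 := congrArg ψ (rho_mul_rho_mul_sigma t hij)
    have h2 := congrArg ψ (rho_mul_self (c := c) i)
    simp only [map_mul, map_one] at h1 h2
    rw [h j i, mul_assoc (ψ (sigma j t)), h2, one_mul, mul_one] at h1
    exact h1.symm
  have hσ : ∀ (k : ℕ) (hk : k < n - 1) (t : Fin c),
      ψ (sigma ⟨k, hk⟩ t) = ψ (sigma ⟨0, by omega⟩ t) := by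
    intro k
    induction k with
    | zero => intro _ _; rfl
    | succ k ih => intro hk t; rw [hstep ⟨k, by omega⟩ _ t rfl, ih]
  have hσ' : ∀ i j t, ψ (sigma i t) = ψ (sigma j t) := fun i j t ↦
    (hσ i i.2 t).trans (hσ j j.2 t).symm
  -- Images do not depend on positions, so these two distant positions can replace any pair.
  let a : Fin (n - 1) := ⟨0, by omega⟩
  let b : Fin (n - 1) := ⟨2, by omega⟩
  have hab : 2 ≤ |(a : ℤ) - (b : ℤ)| := by simp [a, b]
  have hss : ∀ i j t l, ψ (sigma i t) * ψ (sigma j l) = ψ (sigma j l) * ψ (sigma i t) := by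
    intro i j t l
    rw [hσ' i a, hσ' j b, ← map_mul, ← map_mul, sigma_mul_sigma t l hab]
  have hsr : ∀ i j t, ψ (sigma i t) * ψ (rho j) = ψ (rho j) * ψ (sigma i t) := by
    intro i j t
    rw [hσ' i a, h j b, ← map_mul, ← map_mul, sigma_mul_rho t hab]
  have htop : ∀ z : G, (∀ i, ψ (rho i) * z = z * ψ (rho i)) →
      (∀ i t, ψ (sigma i t) * z = z * ψ (sigma i t)) → ∀ x, ψ x * z = z * ψ x := by
    intro z hr hs x
    have : (Subgroup.centralizer {z}).comap ψ = ⊤ := by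
      refine eq_top_of_mem (fun i ↦ ?_) (fun i t ↦ ?_)
      · exact Subgroup.mem_comap.2 (Subgroup.mem_centralizer_singleton_iff.2 (hr i))
      · exact Subgroup.mem_comap.2 (Subgroup.mem_centralizer_singleton_iff.2 (hs i t))
    have hx : x ∈ (Subgroup.centralizer {z}).comap ψ := this ▸ Subgroup.mem_top x
    exact Subgroup.mem_centralizer_singleton_iff.1 (Subgroup.mem_comap.1 hx)
  refine htop _ (fun i ↦ (htop _ (fun j ↦ ?_) (fun j t ↦ ?_) y).symm)
    (fun i t ↦ (htop _ (fun j ↦ ?_) (fun j l ↦ ?_) y).symm) x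
  · rw [h i j]
  · exact hsr j i t
  · exact (hsr i j t).symm
  · exact hss j i l t

/-- The symmetric group maps to `UW_n(c)` by sending adjacent transpositions to the `ρ i`. -/
theorem exists_section (m c : ℕ) : ∃ ι : Perm (Fin (m + 1)) →* UW (m + 1) c,
    ∀ i : Fin m, ι (swap i.castSucc i.succ) = rho (n := m + 1) i := by
  have hr : IsCoxeterFamilyA m
      (fun i ↦ if h : i < m then (rho ⟨i, h⟩ : UW (m + 1) c) else 1) := by
    refine ⟨fun i hi ↦ ?_, fun i hi ↦ ?_, fun i j hij hj ↦ ?_⟩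
    · simp only [hi, dite_true]
      exact rho_mul_self _
    · have hi' : i < m := by omega
      simp only [hi, hi', dite_true]
      exact rho_braid rfl
    · have hi' : i < m := by omega
      simp only [hj, hi', dite_true]
      refine rho_mul_rho ?_
      rw [abs_sub_comm, le_abs]
      left
      push_cast
      omega
  obtain ⟨ι, hι⟩ := hr.exists_hom
  exact ⟨ι, fun i ↦ by rw [hι]; simp [i.2]⟩

theorem exists_hom_perm (m c : ℕ) : ∃ π : UW (m + 1) c →* Perm (Fin (m + 1)),
    (∀ i : Fin m, π (rho i) = swap i.castSucc i.succ) ∧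
      ∀ (i : Fin m) t, π (sigma i t) = swap i.castSucc i.succ := by
  refine exists_hom_of_family (n := m + 1) (s := fun i : Fin m ↦ swap i.castSucc i.succ)
    (fun i ↦ swap_mul_self _ _) (fun i j hij ↦ ?_) (fun i j hij ↦ ?_)
  · have hij' : j.castSucc = i.succ := Fin.ext hij
    have h2 : i.castSucc ≠ j.succ := by
      simp only [ne_eq, Fin.ext_iff, Fin.val_castSucc, Fin.val_succ]; omega
    have h3 : i.succ ≠ j.succ := by
      simp only [ne_eq, Fin.ext_iff, Fin.val_succ]; omega
    simp only [hij']
    exact swap_braid Fin.castSucc_lt_succ.ne h2 h3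
  · rw [le_abs] at hij
    refine swap_commute_of_disjoint ?_ ?_ ?_ ?_ <;>
      (simp only [ne_eq, Fin.ext_iff, Fin.val_castSucc, Fin.val_succ]; omega)

/-- A homomorphism with non-abelian image is injective on the symmetric group generated by the
`ρ i`. -/
theorem injective_comp_section {m c : ℕ} (hm : 5 ≤ m + 1) {ι : Perm (Fin (m + 1)) →* UW (m + 1) c}
    (hι : ∀ i : Fin m, ι (swap i.castSucc i.succ) = rho (n := m + 1) i) {G : Type*} [Group G]
    {ψ : UW (m + 1) c →* G} (hψ : Function.Surjective ψ) (hG : ∃ a b : G, a * b ≠ b * a) :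
    Function.Injective (ψ.comp ι) := by
  refine (injective_or_map_isSwap_eq (by simpa using hm) _).resolve_right fun h ↦ ?_
  obtain ⟨a, b, hab⟩ := hG
  obtain ⟨x, rfl⟩ := hψ a
  obtain ⟨y, rfl⟩ := hψ b
  refine hab (commute_of_map_rho_eq hm ψ (fun i j ↦ ?_) x y)
  change ψ (rho (show Fin m from i)) = ψ (rho (show Fin m from j))
  rw [← hι, ← hι]
  exact h _ _ ⟨_, _, Fin.castSucc_lt_succ.ne, rfl⟩ ⟨_, _, Fin.castSucc_lt_succ.ne, rfl⟩

end UW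

/-! ### Rigidity of surjections onto the symmetric group -/

/-- A permutation that commutes with all adjacent transpositions of the letters from the third on
is trivial or the transposition of the first two letters. -/
theorem eq_one_or_eq_swap_of_commute {m : ℕ} (hm : 5 ≤ m + 1) (x : Perm (Fin (m + 1)))
    (hx : ∀ i : Fin m, 2 ≤ (i : ℕ) →
      x * swap i.castSucc i.succ = swap i.castSucc i.succ * x) :
    x = 1 ∨ x = swap (⟨0, by omega⟩ : Fin (m + 1)) ⟨1, by omega⟩ := by
  have hpair : ∀ (k : ℕ) (hk : k < m), 2 ≤ k →
      swap (x ⟨k, by omega⟩) (x ⟨k + 1, by omega⟩) =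
        swap (⟨k, by omega⟩ : Fin (m + 1)) ⟨k + 1, by omega⟩ := by
    intro k hk h2
    have := hx ⟨k, hk⟩ h2
    rw [swap_apply_apply, mul_inv_eq_iff_eq_mul]
    exact this
  have hmem : ∀ {a b c d : Fin (m + 1)}, c ≠ d → swap a b = swap c d →
      (a = c ∧ b = d) ∨ (a = d ∧ b = c) := by
    intro a b c d hcd h
    have h1 : swap a b c = d := by rw [h, swap_apply_left]
    have h2 : swap a b d = c := by rw [h, swap_apply_right]
    rw [swap_apply_def] at h1 h2
    grind
  have h2 := hmem (by simp) (hpair 2 (by omega) le_rfl)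
  have h3 := hmem (by simp) (hpair 3 (by omega) (by omega))
  -- `x` preserves the pairs `{2, 3}` and `{3, 4}`, hence their common letter `3`. The second pair
  -- needs a fifth letter.
  have hfix2 : x ⟨2, by omega⟩ = ⟨2, by omega⟩ ∧ x ⟨3, by omega⟩ = ⟨3, by omega⟩ := by
    rcases h2 with h2 | h2
    · exact h2
    · rcases h3 with h3 | h3
      · exact absurd (h2.2.symm.trans h3.1) (by simp)
      · exact absurd (h2.2.symm.trans h3.1) (by simp)
  have hfix : ∀ (k : ℕ) (hk : k + 2 < m + 1), x ⟨k + 2, hk⟩ = ⟨k + 2, hk⟩ := by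
    intro k
    induction k with
    | zero => intro _; exact hfix2.1
    | succ k ih =>
      intro hk
      rcases hmem (by simp) (hpair (k + 2) (by omega) (by omega)) with h | h
      · exact h.2
      · have := (ih (by omega)).symm.trans h.1
        simp at this
  have hfix' : ∀ i : Fin (m + 1), 2 ≤ (i : ℕ) → x i = i := by
    intro i hi
    obtain ⟨k, hk⟩ := Nat.exists_eq_add_of_le' hi
    have := hfix k (by omega)
    simpa [← hk] using this
  let a : Fin (m + 1) := ⟨0, by omega⟩
  let b : Fin (m + 1) := ⟨1, by omega⟩
  have hlow : ∀ i : Fin (m + 1), (i : ℕ) < 2 → x i = a ∨ x i = b := by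
    intro i hi
    by_contra! h
    have h2 : 2 ≤ (x i : ℕ) := by
      have h1 : (x i : ℕ) ≠ 0 := fun e ↦ h.1 (Fin.ext e)
      have h2 : (x i : ℕ) ≠ 1 := fun e ↦ h.2 (Fin.ext e)
      omega
    have := x.injective (hfix' _ h2)
    rw [this] at h2
    omega
  have hcases : ∀ i : Fin (m + 1), i = a ∨ i = b ∨ 2 ≤ (i : ℕ) := by
    intro i
    simp only [Fin.ext_iff, a, b]
    omega
  have hab : a ≠ b := by simp [a, b]
  have hxab : x a ≠ x b := fun h ↦ hab (x.injective h)
  have ha := hlow a (by simp [a])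
  have hb := hlow b (by simp [b])
  rcases ha with ha | ha
  · left
    have hb' : x b = b := hb.resolve_left fun h ↦ hxab (ha.trans h.symm)
    ext i
    rcases hcases i with rfl | rfl | hi
    · rw [ha, Perm.one_apply]
    · rw [hb', Perm.one_apply]
    · rw [hfix' i hi, Perm.one_apply]
  · right
    have hb' : x b = a := hb.resolve_right fun h ↦ hxab (ha.trans h.symm)
    ext i
    change _ = ((swap a b i : Fin (m + 1)) : ℕ)
    rcases hcases i with rfl | rfl | hi
    · rw [ha, swap_apply_left]
    · rw [hb', swap_apply_right]
    · rw [hfix' i hi, swap_apply_of_ne_of_ne]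
      · rintro rfl; simp [a] at hi
      · rintro rfl; simp [b] at hi

theorem exists_mul_ne_mul_perm {m : ℕ} (hm : 2 ≤ m) :
    ∃ a b : Perm (Fin (m + 1)), a * b ≠ b * a :=
  ⟨_, _, swap_mul_swap_ne (a := (⟨0, by omega⟩ : Fin (m + 1))) (b := ⟨1, by omega⟩)
    (c := ⟨2, by omega⟩) (by simp) (by simp) (by simp)⟩

namespace UW

/-- A homomorphism to the symmetric group that sends each `ρ i` to an adjacent transposition sends
`σ i t` to the same transposition. -/
theorem map_sigma_eq {m c : ℕ} (hm : 5 ≤ m + 1) {χ : UW (m + 1) c →* Perm (Fin (m + 1))}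
    (hχ : ∀ i : Fin m, χ (rho i) = swap i.castSucc i.succ) (i : Fin m) (t : Fin c) :
    χ (sigma i t) = swap i.castSucc i.succ := by
  have hstep : ∀ i j : Fin m, (j : ℕ) = i + 1 →
      χ (rho i) * χ (rho j) * χ (sigma i t) = χ (sigma j t) * χ (rho i) * χ (rho j) := by
    intro i j hij
    simpa only [map_mul] using congrArg χ (rho_mul_rho_mul_sigma (n := m + 1) (i := i) t hij)
  have hbraid : ∀ i j : Fin m, (j : ℕ) = i + 1 →
      χ (rho i) * χ (rho j) * χ (rho i) = χ (rho j) * χ (rho i) * χ (rho j) := by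
    intro i j hij
    simpa only [map_mul] using congrArg χ (rho_braid (n := m + 1) (c := c) (i := i) hij)
  let a : Fin m := ⟨0, by omega⟩
  let b : Fin m := ⟨1, by omega⟩
  have h0 : χ (sigma a t) = χ (rho a) := by
    have hcomm : ∀ i : Fin m, 2 ≤ (i : ℕ) →
        χ (sigma a t) * swap i.castSucc i.succ = swap i.castSucc i.succ * χ (sigma a t) := by
      intro i hi
      rw [← hχ, ← map_mul, ← map_mul]
      refine congrArg χ (sigma_mul_rho (n := m + 1) (i := a) (j := i) t ?_)
      rw [abs_sub_comm, le_abs]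
      left
      simp [a]
      omega
    rcases eq_one_or_eq_swap_of_commute hm (χ (sigma a t)) hcomm with h | h
    -- If `σ a t` dies, the mixed relation kills `σ b t`, and the welded relation becomes `ρ a = ρ
    -- b` in the image. Without the welded relation all `σ` could be trivial.
    · exfalso
      have hb := hstep a b rfl
      rw [h, mul_one, mul_assoc, right_eq_mul] at hb
      have hw := congrArg χ (welded (n := m + 1) (i := a) (j := b) t rfl)
      simp only [map_mul] at hw
      rw [h, hb, mul_one, mul_one, one_mul, hχ, hχ] at hw
      have := congrArg (fun f : Perm (Fin (m + 1)) ↦ f a.castSucc) hw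
      rw [one_mul, swap_apply_left] at this
      rw [swap_apply_of_ne_of_ne] at this <;> simp [a, b, Fin.ext_iff] at this ⊢
    · rw [h, hχ]
      rfl
  -- The mixed relation conjugates `σ i t` to its neighbour exactly as the braid relation conjugates
  -- `ρ i`.
  have hall : ∀ (k : ℕ) (hk : k < m),
      χ (sigma (⟨k, hk⟩ : Fin m) t) = χ (rho (⟨k, hk⟩ : Fin m)) := by
    intro k
    induction k with
    | zero => intro _; exact h0
    | succ k ih =>
      intro hk
      have h1 := hstep ⟨k, by omega⟩ ⟨k + 1, hk⟩ rfl
      rw [ih, hbraid _ _ rfl] at h1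
      exact (mul_right_cancel (mul_right_cancel h1)).symm
  rw [← hχ]
  exact hall i i.2

/-- Every surjective homomorphism to the symmetric group is the standard one followed by an
automorphism. -/
theorem exists_eq_comp {m c : ℕ} (hm : 5 ≤ m + 1) {π : UW (m + 1) c →* Perm (Fin (m + 1))}
    (hπ : (∀ i : Fin m, π (rho i) = swap i.castSucc i.succ) ∧
      ∀ (i : Fin m) t, π (sigma i t) = swap i.castSucc i.succ)
    {φ : UW (m + 1) c →* Perm (Fin (m + 1))} (hφ : Function.Surjective φ) :
    ∃ α : MulAut (Perm (Fin (m + 1))), ∀ x, φ x = α (π x) := by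
  obtain ⟨ι, hι⟩ := exists_section m c
  have hinj := injective_comp_section hm hι hφ (exists_mul_ne_mul_perm (by omega))
  let α : MulAut (Perm (Fin (m + 1))) := MulEquiv.ofBijective _ hinj.bijective_of_finite
  have hα : ∀ i : Fin m, α.symm (φ (rho i)) = swap i.castSucc i.succ := by
    intro i
    rw [MulEquiv.symm_apply_eq]
    simp only [α, MulEquiv.ofBijective_apply, MonoidHom.comp_apply, hι]
  have hr : ∀ i : Fin m, (α.symm.toMonoidHom.comp φ) (rho i) = swap i.castSucc i.succ := hα
  have : α.symm.toMonoidHom.comp φ = π :=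
    hom_ext (fun i ↦ (hr i).trans (hπ.1 i).symm)
      (fun i t ↦ (map_sigma_eq hm hr i t).trans (hπ.2 i t).symm)
  exact ⟨α, fun x ↦ (α.symm_apply_eq.1 (DFunLike.congr_fun this x))⟩

end UW

/-! ### The main theorem -/

theorem theorem5p6 (n c : ℕ) (hn : 5 ≤ n) (hc : 1 ≤ c) :
    -- the symmetric group is a quotient
    (∃ π : UW n c →* Equiv.Perm (Fin n), Function.Surjective π) ∧
    -- every finite non-abelian quotient has order at least `n!`
    (∀ (G : Type*) [Group G] [Finite G] (ψ : UW n c →* G), Function.Surjective ψ →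
      (∃ a b : G, a * b ≠ b * a) → n.factorial ≤ Nat.card G) ∧
    -- every non-abelian quotient of order `n!` is isomorphic to the symmetric group
    (∀ (G : Type*) [Group G] (ψ : UW n c →* G), Function.Surjective ψ →
      (∃ a b : G, a * b ≠ b * a) → Nat.card G = n.factorial →
      Nonempty (G ≃* Equiv.Perm (Fin n))) ∧
    -- for `n ≠ 6` the quotient map onto the symmetric group is unique up to conjugation
    (n ≠ 6 → ∀ φ ψ : UW n c →* Equiv.Perm (Fin n),
      Function.Surjective φ → Function.Surjective ψ → ConjugateHoms φ ψ) ∧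
    -- for `n = 6` there are, up to conjugation, exactly two quotient maps onto the symmetric
    -- group, and they differ by the exceptional outer automorphism
    (n = 6 →
      (∃ ν : MulAut (Equiv.Perm (Fin n)), IsNonInner ν) ∧
      ∀ ν : MulAut (Equiv.Perm (Fin n)), IsNonInner ν →
        ∀ φ : UW n c →* Equiv.Perm (Fin n), Function.Surjective φ →
          Function.Surjective (ν.toMonoidHom.comp φ) ∧
          ¬ ConjugateHoms φ (ν.toMonoidHom.comp φ) ∧
          ∀ ψ : UW n c →* Equiv.Perm (Fin n), Function.Surjective ψ →
            ConjugateHoms φ ψ ∨ ConjugateHoms (ν.toMonoidHom.comp φ) ψ) := by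
  obtain ⟨m, rfl⟩ : ∃ m, n = m + 1 := ⟨n - 1, by omega⟩
  obtain ⟨ι, hι⟩ := UW.exists_section m c
  obtain ⟨π, hπ⟩ := UW.exists_hom_perm m c
  have hcardS : Nat.card (Perm (Fin (m + 1))) = (m + 1).factorial := by
    rw [Nat.card_perm, Nat.card_fin]
  have hdiff : ∀ φ ψ : UW (m + 1) c →* Perm (Fin (m + 1)), Function.Surjective φ →
      Function.Surjective ψ → ∃ β : MulAut (Perm (Fin (m + 1))), ∀ x, ψ x = β (φ x) := by
    intro φ ψ hφ hψ
    obtain ⟨α, hα⟩ := UW.exists_eq_comp hn hπ hφ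
    obtain ⟨α', hα'⟩ := UW.exists_eq_comp hn hπ hψ
    exact ⟨α' * α⁻¹, fun x ↦ by rw [MulAut.mul_apply, hα, MulAut.inv_apply_self, hα']⟩
  refine ⟨⟨π, ?_⟩, ?_, ?_, ?_, ?_⟩
  · rw [← MonoidHom.range_eq_top, eq_top_iff, ← Subgroup.toSubmonoid_le, Subgroup.top_toSubmonoid,
      ← mclosure_swap_castSucc_succ, Submonoid.closure_le]
    rintro _ ⟨i, rfl⟩
    exact ⟨_, hπ.1 i⟩
  · intro G _ _ ψ hψ hG
    rw [← hcardS]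
    exact Nat.card_le_card_of_injective _ (UW.injective_comp_section hn hι hψ hG)
  · intro G _ ψ hψ hG hcard
    have hinj := UW.injective_comp_section hn hι hψ hG
    have : Finite G := Nat.finite_of_card_ne_zero (hcard ▸ (m + 1).factorial_ne_zero)
    have hbij := hinj.bijective_of_nat_card_le (by rw [hcard, hcardS])
    exact ⟨(MulEquiv.ofBijective _ hbij).symm⟩
  · intro h6 φ ψ hφ hψ
    obtain ⟨β, hβ⟩ := hdiff φ ψ hφ hψ
    obtain ⟨g, rfl⟩ := MulAut.exists_eq_conj (by simpa using hn) (by simpa using h6) β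
    exact ⟨g, hβ⟩
  · intro h6
    obtain rfl : m = 5 := by omega
    refine ⟨exists_isNonInner_perm_six, fun ν hν φ hφ ↦ ⟨ν.surjective.comp hφ, ?_, ?_⟩⟩
    · rintro ⟨g, hg⟩
      refine hν ⟨g, MulEquiv.ext fun y ↦ ?_⟩
      obtain ⟨x, rfl⟩ := hφ y
      exact hg x
    · intro ψ hψ
      obtain ⟨β, hβ⟩ := hdiff φ ψ hφ hψ
      by_cases hin : IsNonInner β
      -- Both `β` and `ν⁻¹` are non-inner, so `β * ν⁻¹` is inner and carries `ν ∘ φ` to `ψ`.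
      · obtain ⟨g, hg⟩ := hin.exists_mul_eq_conj (by simp) hν.inv
        refine Or.inr ⟨g, fun x ↦ ?_⟩
        have := DFunLike.congr_fun hg (ν (φ x))
        rw [MulAut.mul_apply, MulAut.inv_apply_self, MulAut.conj_apply] at this
        exact (hβ x).trans this
      · obtain ⟨g, rfl⟩ := not_not.1 hin
        exact Or.inl ⟨g, hβ⟩
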